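/- Let $\Theta\subseteq\mathbb R$ be an interval with more than one point, $b:\Theta\to\mathbb R$ strictly convex and twice differentiable (one-sided derivatives at endpoints belonging to $\Theta$), and $m$ a measure on $\mathbb R$ such that for every $\theta\in\Theta$ the function $x\mapsto e^{x\theta-b(\theta)}$ is a probability density with respect to $m$; let $\nu_\theta$ be the corresponding distribution (a one-parameter canonical exponential family). Put $\mathcal I=\dot b(\Theta)$, and for $\mu,\mu'\in\mathcal I$ let $\nu^\mu=\nu_{\dot b^{-1}(\mu)}$ (the member of the family with mean $\mu$) and $d(\mu,\mu')=\mathrm{KL}(\nu^\mu,\nu^{\mu'})$. Let $\mathcal O_1,\dots,\mathcal O_M$ be pairwise disjoint subsets of $\mathcal I^K$, open in $\mathcal I^K$, and $\mathcal O=\bigcup_i\mathcal O_i$. For $\boldsymbol\mu\in\mathcal I^K$ let $\mathrm{Alt}(\boldsymbol\mu)=\bigcup_{i:\boldsymbol\mu\notin\mathcal O_i}\mathcal O_i$. In the bandit model $\boldsymbol\mu=(\mu_1,\dots,\mu_K)\in\mathcal I^K$, at each round $t=1,2,\dots$ an arm $A_t\in\{1,\dots,K\}$ is selected and, given the past and $A_t$,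 an observation $X_t$ is drawn from $\nu^{\mu_{A_t}}$. Let $\mathcal F_t=\sigma(A_1,X_1,\dots,A_t,X_t)$. A strategy consists of a sampling rule, for which $A_t$ is a measurable function of $A_1,X_1,\dots,A_{t-1},X_{t-1}$ and of a variable $U_t$ that is uniform on $[0,1]$ and independent of $\mathcal F_{t-1}$; a stopping time $\tau_\delta\in\mathbb N\cup\{\infty\}$ with respect to $(\mathcal F_t)$; and an $\mathcal F_{\tau_\delta}$-measurable recommendation $\hat\imath\in\{1,\dots,M\}$. These rules do not depend on $\boldsymbol\mu$; $\mathbb P_{\boldsymbol\mu}$ and $\mathbb E_{\boldsymbol\mu}$ refer to the model $\boldsymbol\mu$. For $\delta\in(0,1]$ the strategy is called $\delta$-correct if $$\forall\boldsymbol\mu\in\mathcal O,\qquad \mathbb P_{\boldsymbol\mu}\big(\tau_\delta<\infty,\ \boldsymbol\mu\notin\mathcal O_{\hat\imath}\big)\le\delta ,$$ which holds in particular if $\mathbb P_{\boldsymbol\mu}(\boldsymbol\mu\in\mathcal O_{\hat\imath})\ge 1-\delta$ for all $\boldsymbol\mu\in\mathcal O$. **Proposition 5.2.** Define $T^*(\boldsymbol\mu)\in[0,\infty]$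 by $$T^*(\boldsymbol\mu)^{-1}=\sup_{\boldsymbol w\in\Sigma_K}\ \inf_{\boldsymbol\lambda\in\mathrm{Alt}(\boldsymbol\mu)}\ \sum_{a=1}^K w_a\,d(\mu_a,\lambda_a),\qquad \Sigma_K=\Big\{\boldsymbol w\in[0,1]^K:\sum_{a=1}^K w_a=1\Big\},$$ with the conventions $\inf\emptyset=\infty$, $1/0=\infty$, $1/\infty=0$. Then for every $\delta\in(0,1]$, every $\delta$-correct strategy satisfies $$\forall\boldsymbol\mu\in\mathcal O,\qquad \mathbb E_{\boldsymbol\mu}[\tau_\delta]\ \ge\ T^*(\boldsymbol\mu)\,\ln\Big(\frac1{3\delta}\Big)$$ (with $\infty\cdot 0=0$). -/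

import Mathlib

open MeasureTheory ProbabilityTheory InformationTheory
open scoped ENNReal unitInterval

noncomputable section

/-- A one-parameter canonical exponential family on `ℝ`: a convex set `Θ` of natural parameters,
a strictly convex, twice differentiable log-partition function `b` on `Θ`, and a reference
measure `m`, such that `x ↦ exp (x θ - b θ)` is a probability density with respect to `m` for
every `θ ∈ Θ`. Derivatives are taken within `Θ`, so `Θ` need not be open; convexity of `Θ` is part
of `StrictConvexOn`. Only the values of `b` on `Θ` matter. -/
structure ExpFamily where
  Θ : Set ℝ
  b : ℝ → ℝ
  m : Measure ℝ
  nontrivial : Θ.Nontrivial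
  strictConvex : StrictConvexOn ℝ Θ b
  differentiable : DifferentiableOn ℝ b Θ
  twice_differentiable : DifferentiableOn ℝ (derivWithin b Θ) Θ
  isProbability : ∀ θ ∈ Θ,
    IsProbabilityMeasure (m.withDensity fun x => ENNReal.ofReal (Real.exp (x * θ - b θ)))

namespace ExpFamily

variable (E : ExpFamily)

/-- The set `I = b'(Θ)` of possible means. -/
def meanSet : Set ℝ := derivWithin E.b E.Θ '' E.Θ

/-- The natural parameter `(b')⁻¹(μ)` of the member of the family with mean `μ`
(`b'` is injective on `Θ` because `b` is strictly convex). -/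
def naturalParam (μ : E.meanSet) : ℝ := Function.invFunOn (derivWithin E.b E.Θ) E.Θ μ

/-- `ν^μ`, the member of the family with mean `μ`. -/
def dist (μ : E.meanSet) : Measure ℝ :=
  E.m.withDensity fun x =>
    ENNReal.ofReal (Real.exp (x * E.naturalParam μ - E.b (E.naturalParam μ)))

instance (μ : E.meanSet) : IsProbabilityMeasure (E.dist μ) :=
  E.isProbability _ (Function.invFunOn_mem μ.2)

/-- `d(μ, μ') = KL(ν^μ, ν^{μ'})`. -/
def d (μ μ' : E.meanSet) : ℝ≥0∞ := klDiv (E.dist μ) (E.dist μ')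

end ExpFamily

/-- A sequential identification problem with `K` arms from the family `E` and `M` hypotheses: the
cells `O_1, …, O_M` are pairwise disjoint open subsets of the set `I^K` of vectors of means. -/
structure IdentificationProblem (E : ExpFamily) (K M : ℕ) where
  cell : Fin M → Set (Fin K → E.meanSet)
  isOpen_cell : ∀ i, IsOpen (cell i)
  disjoint_cell : Pairwise fun i j => Disjoint (cell i) (cell j)

namespace IdentificationProblem

variable {E : ExpFamily} {K M : ℕ} (P : IdentificationProblem E K M)

/-- The set `O` of possible vectors of means, partitioned by the cells. -/
def params : Set (Fin K → E.meanSet) := ⋃ i, P.cell i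

/-- `Alt(μ)`: the union of the cells that do not contain `μ`. -/
def alt (μ : Fin K → E.meanSet) : Set (Fin K → E.meanSet) := ⋃ i, ⋃ _ : μ ∉ P.cell i, P.cell i

/-- The complexity `T*(μ) ∈ [0, ∞]`, the inverse of
`sup_{w ∈ Σ_K} inf_{lam ∈ Alt(μ)} ∑ a, w_a d(μ_a, lam_a)`. -/
def complexity (μ : Fin K → E.meanSet) : ℝ≥0∞ :=
  (⨆ w ∈ stdSimplex ℝ (Fin K), ⨅ lam ∈ P.alt μ,
    ∑ a, ENNReal.ofReal (w a) * E.d (μ a) (lam a))⁻¹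

end IdentificationProblem

/-- An infinite record of play: entry `t` is the pair (arm, observation) of round `t + 1`. -/
abbrev Trajectory (K : ℕ) : Type := ℕ → Fin K × ℝ

/-- `F_t = σ(A_1, X_1, …, A_t, X_t)`: the information of the first `t` rounds, `F_0` being
trivial. -/
def obsFiltration (K : ℕ) :
    Filtration ℕ (inferInstance : MeasurableSpace (Trajectory K)) where
  seq t := MeasurableSpace.comap (fun ω (s : Fin t) => ω s) inferInstance
  mono' := by
    intro s t hst
    have h : (fun (ω : Trajectory K) (i : Fin s) => ω i) =
        (fun (v : Fin t → Fin K × ℝ) (i : Fin s) => v (Fin.castLE hst i)) ∘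
          (fun ω (i : Fin t) => ω i) := rfl
    change MeasurableSpace.comap _ _ ≤ MeasurableSpace.comap _ _
    rw [h, ← MeasurableSpace.comap_comp]
    apply MeasurableSpace.comap_mono
    apply Measurable.comap_le
    fun_prop
  le' := by
    intro t
    apply Measurable.comap_le
    fun_prop

/-- A (randomized) sampling rule: in every round the arm is a measurable function of all the
previous arms and observations and of a fresh uniform variable in `[0, 1]`. The arm of the first
round is `first U_1`; the arm of the round that follows the entries `0, …, n` of the trajectory is
`next n (entries) U`. -/
structure SamplingRule (K : ℕ) where
  first : I → Fin K
  next : (n : ℕ) → (Finset.Iic n → Fin K × ℝ) → I → Fin K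
  measurable_first : Measurable first
  measurable_next : ∀ n, Measurable fun p : (Finset.Iic n → Fin K × ℝ) × I => next n p.1 p.2

namespace SamplingRule

variable {K : ℕ} (S : SamplingRule K)

/-- The law of the first arm. -/
def firstArm : Measure (Fin K) := (volume : Measure I).map S.first

instance : IsProbabilityMeasure S.firstArm :=
  Measure.isProbabilityMeasure_map S.measurable_first.aemeasurable

/-- The conditional law of the next arm given the past. -/
def nextArm (n : ℕ) : Kernel (Finset.Iic n → Fin K × ℝ) (Fin K) :=
  (Kernel.id ×ₖ Kernel.const _ (volume : Measure I)).map fun p => S.next n p.1 p.2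

instance (n : ℕ) : IsMarkovKernel (S.nextArm n) :=
  Kernel.IsMarkovKernel.map _ (S.measurable_next n)

/-- The law of the observation given the selected arm. -/
def armKernel {E : ExpFamily} (μ : Fin K → E.meanSet) : Kernel (Fin K) ℝ :=
  Kernel.ofFunOfCountable fun a => E.dist (μ a)

instance {E : ExpFamily} (μ : Fin K → E.meanSet) : IsMarkovKernel (armKernel μ) :=
  ⟨fun a => inferInstanceAs (IsProbabilityMeasure (E.dist (μ a)))⟩

/-- `P_μ`: the law of the arms and observations when the sampling rule `S` is used in the bandit
model with vector of means `μ`. -/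
def law {E : ExpFamily} (μ : Fin K → E.meanSet) : Measure (Trajectory K) :=
  Kernel.trajMeasure (X := fun _ => Fin K × ℝ) (S.firstArm ⊗ₘ armKernel μ)
    fun n => S.nextArm n ⊗ₖ Kernel.prodMkLeft _ (armKernel μ)

end SamplingRule

/-- A strategy for a problem with `K` arms and `M` hypotheses: a sampling rule, a stopping rule
`τ` (a stopping time for the observations, possibly infinite) and a recommendation, which depends
only on what was observed up to the time `τ`. -/
structure Strategy (K M : ℕ) where
  sampling : SamplingRule K
  τ : Trajectory K → WithTop ℕ
  isStoppingTime : IsStoppingTime (obsFiltration K) τ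
  recommend : Trajectory K → Fin M
  measurable_recommend : Measurable[isStoppingTime.measurableSpace] recommend

namespace Strategy

variable {E : ExpFamily} {K M : ℕ} (A : Strategy K M)

/-- `E_μ[τ] ∈ [0, ∞]`. -/
def expectedTime (μ : Fin K → E.meanSet) : ℝ≥0∞ :=
  ∫⁻ ω, ENat.toENNReal (A.τ ω) ∂(A.sampling.law μ)

/-- `δ`-correctness: for every `μ ∈ O`, the probability to stop with a wrong recommendation is at
most `δ`. It is implied by `P_μ(μ ∈ O_î) ≥ 1 - δ` for every `μ ∈ O`, and equivalent to it for a
strategy that stops almost surely. -/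
def IsDeltaCorrect (P : IdentificationProblem E K M) (δ : ℝ) : Prop :=
  ∀ μ ∈ P.params,
    A.sampling.law μ {ω | A.τ ω ≠ ⊤ ∧ μ ∉ P.cell (A.recommend ω)} ≤ ENNReal.ofReal δ

end Strategy

end

/-! Fix `μ` with finite expected duration and `lam` in Alt(μ). Let J be the set of indices of cells
containing `μ`, and Z the likelihood ratio of `lam` to `μ` at the stopping time. The strategy stops
with a recommendation in J with probability at least 1 - δ under `μ` and at most δ under `lam`.
Telling the two models apart costs information: with N_a the number of pulls of arm a, ∑ E_μ[N_a]
d(μ_a, lam_a) ≥ (1 - 2δ) log((1 - δ)/δ) ≥ log(1/(3δ)). Dividing by E_μ[τ] = ∑ E_μ[N_a] turns the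
expected pulls into a point of the simplex that does not depend on `lam`, so its infimum over Alt(μ)
is bounded by the supremum defining T*.

The information inequality comes from log x ≤ x - 1 at x = rZ on J and x = Z/r off J, where r = (1 -
δ)/δ (`stopped_pointwise_bound`). Writing the divergence as the integral of the nonnegative function
z - 1 - log z keeps all terms in [0, ∞]: Wald's identity (`lintegral_stoppedSum`) reduces to
Tonelli, log-likelihoods need not be integrable, and infinite divergences need no separate case. The
change of measure at the stopping time is `lintegral_stoppedRatio`. -/

noncomputable section

/-! ### Binary divergence and Kullback–Leibler divergence -/

/-- The binary divergence between `1 - δ` and `δ` is at least `log (1 / (3 δ))`. -/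
theorem log_one_div_three_mul_le {δ : ℝ} (h0 : 0 < δ) (h1 : δ < 1 / 2) :
    Real.log (1 / (3 * δ)) ≤ (1 - 2 * δ) * Real.log ((1 - δ) / δ) := by
  -- After expansion the claim is (1 - 2δ)(-log(1 - δ)) + 2δ(-log δ) ≤ log 3; the two terms are at
  -- most 1/5 and 4/5.
  have h3 : 1 ≤ Real.log 3 := by
    rw [Real.le_log_iff_exp_le (by norm_num)]
    linarith [Real.exp_one_lt_d9]
  have he := Real.exp_one_gt_d9
  have hlog1 : -Real.log (1 - δ) ≤ δ / (1 - δ) := by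
    have := Real.log_le_sub_one_of_pos (x := (1 - δ)⁻¹) (by simp; linarith)
    rw [Real.log_inv] at this
    refine this.trans (le_of_eq ?_)
    have : 1 - δ ≠ 0 := by linarith
    field_simp
    ring
  have hlog2 : -Real.log δ ≤ δ⁻¹ / Real.exp 1 := by
    have := Real.log_le_sub_one_of_pos (x := δ⁻¹ / Real.exp 1) (by positivity)
    rw [Real.log_div (by positivity) (by positivity), Real.log_exp, Real.log_inv] at this
    linarith
  have h4 : (1 - 2 * δ) * -Real.log (1 - δ) ≤ 1 / 5 := by
    refine (mul_le_mul_of_nonneg_left hlog1 (by linarith)).trans ?_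
    rw [mul_div_assoc', div_le_iff₀ (by linarith)]
    -- The inequality is 10δ² - 6δ + 1 ≥ 0, and (10δ - 3)² = 10(10δ² - 6δ + 0.9).
    nlinarith [sq_nonneg (10 * δ - 3)]
  have h5 : 2 * δ * -Real.log δ ≤ 4 / 5 := by
    refine (mul_le_mul_of_nonneg_left hlog2 (by linarith)).trans ?_
    have : 2 * δ * (δ⁻¹ / Real.exp 1) = 2 / Real.exp 1 := by field_simp
    rw [this, div_le_iff₀ (by positivity)]
    linarith
  rw [Real.log_div (by norm_num) (by positivity), Real.log_mul (by norm_num) (by positivity),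
    Real.log_div (by linarith) (by positivity), Real.log_one]
  nlinarith

theorem withDensity_exp_ratio {α : Type*} [MeasurableSpace α] (m : Measure α) {f g : α → ℝ}
    (hf : Measurable f) (hg : Measurable g) :
    m.withDensity (fun x => ENNReal.ofReal (Real.exp (g x))) =
      (m.withDensity fun x => ENNReal.ofReal (Real.exp (f x))).withDensity
        fun x => ENNReal.ofReal (Real.exp (g x - f x)) := by
  rw [← withDensity_mul _ (by fun_prop) (by fun_prop)]
  congr 1
  ext x
  simp only [Pi.mul_apply]
  rw [← ENNReal.ofReal_mul (Real.exp_nonneg _), ← Real.exp_add]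
  congr 2
  ring

/-- With dν = z dμ, the `klFun` integrand (1/z) log(1/z) + 1 - 1/z against ν becomes z - 1 - log z
against μ. It is nonnegative, so the formula also covers infinite divergence. -/
theorem klDiv_eq_lintegral_of_withDensity {α : Type*} [MeasurableSpace α] {μ ν : Measure α}
    [IsFiniteMeasure μ] [IsFiniteMeasure ν] {z : α → ℝ} (hz : Measurable z) (hpos : ∀ x, 0 < z x)
    (hν : ν = μ.withDensity fun x => ENNReal.ofReal (z x)) :
    klDiv μ ν = ∫⁻ x, ENNReal.ofReal (z x - 1 - Real.log (z x)) ∂μ := by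
  have hμ : μ = ν.withDensity fun x => ENNReal.ofReal (z x)⁻¹ := by
    rw [hν, ← withDensity_mul _ (by fun_prop) (by fun_prop)]
    conv_lhs => rw [← withDensity_one (μ := μ)]
    congr 1
    ext x
    simp only [Pi.mul_apply, Pi.one_apply]
    rw [← ENNReal.ofReal_mul (hpos x).le, mul_inv_cancel₀ (hpos x).ne', ENNReal.ofReal_one]
  have hac : μ ≪ ν := by
    conv_lhs => rw [hμ]
    exact withDensity_absolutelyContinuous _ _
  have hrn : μ.rnDeriv ν =ᵐ[ν] fun x => ENNReal.ofReal (z x)⁻¹ := by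
    conv_lhs => rw [hμ]
    exact Measure.rnDeriv_withDensity ν (by fun_prop)
  rw [klDiv_eq_lintegral_klFun_of_ac hac]
  have h1 : ∫⁻ x, ENNReal.ofReal (klFun (μ.rnDeriv ν x).toReal) ∂ν =
      ∫⁻ x, ENNReal.ofReal (klFun (z x)⁻¹) ∂ν := by
    refine lintegral_congr_ae ?_
    filter_upwards [hrn] with x hx
    rw [hx, ENNReal.toReal_ofReal (inv_nonneg.2 (hpos x).le)]
  have hm : Measurable fun x => ENNReal.ofReal (klFun (z x)⁻¹) := by fun_prop
  rw [h1, hν, lintegral_withDensity_eq_lintegral_mul _ (by fun_prop) hm]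
  refine lintegral_congr fun x => ?_
  simp only [Pi.mul_apply]
  rw [← ENNReal.ofReal_mul (hpos x).le, klFun_apply, Real.log_inv]
  congr 1
  have := (hpos x).ne'
  field_simp
  ring

/-! ### Events of finitely many rounds -/

/-- Events of the first `n + 1` rounds are determined by the entries `0, …, n`. -/
theorem exists_preimage_frestrictLe {K n : ℕ} {s : Set (Trajectory K)}
    (hs : MeasurableSet[obsFiltration K (n + 1)] s) :
    ∃ B : Set (Finset.Iic n → Fin K × ℝ), MeasurableSet B ∧
      s = Preorder.frestrictLe (π := fun _ => Fin K × ℝ) n ⁻¹' B := by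
  obtain ⟨B, hB, rfl⟩ := hs
  refine ⟨(fun u (i : Fin (n + 1)) =>
    u ⟨i, Finset.mem_Iic.2 (Nat.lt_succ_iff.1 i.2)⟩) ⁻¹' B, ?_, rfl⟩
  exact measurableSet_preimage (by fun_prop) hB

theorem obsFiltration_zero {K : ℕ} {s : Set (Trajectory K)}
    (hs : MeasurableSet[obsFiltration K 0] s) : s = ∅ ∨ s = Set.univ := by
  obtain ⟨B, hB, rfl⟩ := hs
  by_cases h : (fun i => i.elim0 : Fin 0 → Fin K × ℝ) ∈ B
  · right
    ext ω
    simp only [Set.mem_preimage, Set.mem_univ, iff_true]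
    convert h
  · left
    ext ω
    simp only [Set.mem_preimage, Set.mem_empty_iff_false, iff_false]
    convert h

/-! ### One-step structure of the law and change of measure -/

namespace SamplingRule

variable {K : ℕ} (S : SamplingRule K) {E : ExpFamily} (μ : Fin K → E.meanSet)

instance : IsProbabilityMeasure (S.law μ) := by
  unfold law; infer_instance

theorem lintegral_law_zero {φ : Fin K × ℝ → ℝ≥0∞} (hφ : Measurable φ) :
    ∫⁻ ω, φ (ω 0) ∂(S.law μ) = ∫⁻ a, ∫⁻ x, φ (a, x) ∂(E.dist (μ a)) ∂S.firstArm := by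
  have h0 : (S.law μ).map (fun ω => ω 0) = S.firstArm ⊗ₘ armKernel μ := by
    have : (fun ω : Trajectory K => ω 0) =
        (fun u : Finset.Iic 0 → Fin K × ℝ => u ⟨0, by simp⟩) ∘
          Preorder.frestrictLe (π := fun _ => Fin K × ℝ) 0 := rfl
    rw [this, ← Measure.map_map (by fun_prop) (by fun_prop), law, Kernel.trajMeasure,
      Measure.map_comp _ _ (by fun_prop), Kernel.traj_map_frestrictLe, Kernel.partialTraj_self,
      Measure.id_comp, Measure.map_map (by fun_prop) (by fun_prop)]
    exact Measure.map_id
  rw [← lintegral_map (f := φ) (g := fun ω : Trajectory K => ω 0) hφ (by fun_prop), h0,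
    Measure.lintegral_compProd hφ]
  rfl

theorem lintegral_law_succ (n : ℕ) {F : (Finset.Iic n → Fin K × ℝ) × (Fin K × ℝ) → ℝ≥0∞}
    (hF : Measurable F) :
    ∫⁻ ω, F (Preorder.frestrictLe (π := fun _ => Fin K × ℝ) n ω, ω (n + 1)) ∂(S.law μ) =
      ∫⁻ ω, ∫⁻ a, ∫⁻ x, F (Preorder.frestrictLe (π := fun _ => Fin K × ℝ) n ω, (a, x))
        ∂(E.dist (μ a)) ∂(S.nextArm n (Preorder.frestrictLe (π := fun _ => Fin K × ℝ) n ω))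
        ∂(S.law μ) := by
  have h := Kernel.map_frestrictLe_trajMeasure_compProd_eq_map_trajMeasure
    (X := fun _ => Fin K × ℝ) (μ₀ := S.firstArm ⊗ₘ armKernel μ)
    (κ := fun n => S.nextArm n ⊗ₖ Kernel.prodMkLeft _ (armKernel μ)) (a := n)
  change (S.law μ).map _ ⊗ₘ _ = (S.law μ).map _ at h
  rw [← lintegral_map (f := F) (g := fun ω : Trajectory K =>
    (Preorder.frestrictLe (π := fun _ => Fin K × ℝ) n ω, ω (n + 1))) hF (by fun_prop), ← h,
    Measure.lintegral_compProd hF, lintegral_map (Measurable.lintegral_kernel_prod_right' hF)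
      (by fun_prop)]
  refine lintegral_congr fun ω => ?_
  exact Kernel.lintegral_compProd _ _ _
    (f := fun y => F (Preorder.frestrictLe (π := fun _ => Fin K × ℝ) n ω, y)) (by fun_prop)

/-- Given the past and the arm, the observation is drawn from the distribution of the arm. -/
theorem setLIntegral_law {n : ℕ} {s : Set (Trajectory K)}
    (hs : MeasurableSet[obsFiltration K n] s) {φ : Fin K × ℝ → ℝ≥0∞} (hφ : Measurable φ) :
    ∫⁻ ω in s, φ (ω n) ∂(S.law μ) =
      ∫⁻ ω in s, ∫⁻ x, φ ((ω n).1, x) ∂(E.dist (μ (ω n).1)) ∂(S.law μ) := by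
  have hψ : Measurable fun y : Fin K × ℝ => ∫⁻ x, φ (y.1, x) ∂(E.dist (μ y.1)) :=
    (measurable_of_countable fun a => ∫⁻ x, φ (a, x) ∂(E.dist (μ a))).comp measurable_fst
  cases n with
  | zero =>
    rcases obsFiltration_zero hs with rfl | rfl
    · simp
    · rw [setLIntegral_univ, setLIntegral_univ, S.lintegral_law_zero μ hφ,
        S.lintegral_law_zero μ hψ]
      simp
  | succ n =>
    obtain ⟨B, hB, rfl⟩ := exists_preimage_frestrictLe hs
    -- The right side involves χ only through its averages over the observation for each arm, and
    -- these are the same for φ and for its averaged version.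
    have key : ∀ χ : Fin K × ℝ → ℝ≥0∞, Measurable χ →
        ∫⁻ ω in Preorder.frestrictLe (π := fun _ => Fin K × ℝ) n ⁻¹' B, χ (ω (n + 1)) ∂(S.law μ) =
        ∫⁻ ω, B.indicator 1 (Preorder.frestrictLe (π := fun _ => Fin K × ℝ) n ω) *
          ∫⁻ a, ∫⁻ x, χ (a, x) ∂(E.dist (μ a))
            ∂(S.nextArm n (Preorder.frestrictLe (π := fun _ => Fin K × ℝ) n ω)) ∂(S.law μ) := by
      intro χ hχ
      have hI : Measurable (B.indicator (1 : (Finset.Iic n → Fin K × ℝ) → ℝ≥0∞)) :=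
        measurable_one.indicator hB
      have h := S.lintegral_law_succ μ n (F := fun p => B.indicator 1 p.1 * χ p.2) (by fun_prop)
      rw [← lintegral_indicator (measurableSet_preimage (by fun_prop) hB)]
      refine Eq.trans (lintegral_congr fun ω => ?_) (h.trans (lintegral_congr fun ω => ?_))
      · by_cases hω : Preorder.frestrictLe (π := fun _ => Fin K × ℝ) n ω ∈ B
        · simp [Set.indicator, hω]
        · simp [Set.indicator, hω]
      · rw [← lintegral_const_mul _ (measurable_of_countable _)]
        refine lintegral_congr fun a => ?_
        dsimp only
        exact lintegral_const_mul _ (by fun_prop)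
    rw [key φ hφ, key _ hψ]
    simp

variable {μ} {lam : Fin K → E.meanSet} {z : Fin K × ℝ → ℝ≥0∞}

/-- The concatenation of the entries `0, …, n` with the entry `n + 1`. -/
def snocIic {X : Type*} (n : ℕ) (p : (Finset.Iic n → X) × X) : Finset.Iic (n + 1) → X :=
  fun i => if h : (i : ℕ) ≤ n then p.1 ⟨i, Finset.mem_Iic.2 h⟩ else p.2

theorem measurable_snocIic {X : Type*} [MeasurableSpace X] (n : ℕ) :
    Measurable (snocIic (X := X) n) := by
  refine measurable_pi_lambda _ fun i => ?_
  unfold snocIic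
  split_ifs <;> fun_prop

theorem snocIic_frestrictLe {X : Type*} (n : ℕ) (ω : ℕ → X) :
    snocIic n (Preorder.frestrictLe (π := fun _ => X) n ω, ω (n + 1)) =
      Preorder.frestrictLe (π := fun _ => X) (n + 1) ω := by
  ext i
  have := Finset.mem_Iic.1 i.2
  unfold snocIic
  split_ifs with h
  · rfl
  · have : (i : ℕ) = n + 1 := by omega
    simp [this]

/-- The arm kernels are common to both models and cancel; each round contributes only the density
ratio of its observation. -/
theorem lintegral_law_eq_mul_prod (hz : Measurable z)
    (hd : ∀ a, E.dist (lam a) = (E.dist (μ a)).withDensity fun x => z (a, x)) (n : ℕ)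
    {h : (Finset.Iic n → Fin K × ℝ) → ℝ≥0∞} (hh : Measurable h) :
    ∫⁻ ω, h (Preorder.frestrictLe (π := fun _ => Fin K × ℝ) n ω) ∂(S.law lam) =
      ∫⁻ ω, h (Preorder.frestrictLe (π := fun _ => Fin K × ℝ) n ω) *
        ∏ i ∈ Finset.range (n + 1), z (ω i) ∂(S.law μ) := by
  have hchange : ∀ a, ∀ g : ℝ → ℝ≥0∞, Measurable g →
      ∫⁻ x, g x ∂(E.dist (lam a)) = ∫⁻ x, g x * z (a, x) ∂(E.dist (μ a)) := by
    intro a g hg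
    rw [hd a, lintegral_withDensity_eq_lintegral_mul _ (by fun_prop) hg]
    simp [mul_comm]
  induction n with
  | zero =>
    have h1 : ∀ ω : Trajectory K, h (Preorder.frestrictLe (π := fun _ => Fin K × ℝ) 0 ω) =
        h (fun _ => ω 0) := by
      intro ω
      congr 1
      funext i
      have : (i : ℕ) = 0 := Nat.le_zero.1 (Finset.mem_Iic.1 i.2)
      simp [this]
    simp_rw [h1, zero_add, Finset.prod_range_one]
    rw [S.lintegral_law_zero lam (φ := fun y => h fun _ => y) (by fun_prop),
      S.lintegral_law_zero μ (φ := fun y => (h fun _ => y) * z y) (by fun_prop)]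
    exact lintegral_congr fun a => hchange a _ (by fun_prop)
  | succ n ih =>
    have hs := measurable_snocIic (X := Fin K × ℝ) n
    simp_rw [← snocIic_frestrictLe]
    rw [S.lintegral_law_succ lam n (F := fun p => h (snocIic n p)) (by fun_prop)]
    have hin : Measurable fun u : Finset.Iic n → Fin K × ℝ =>
        ∫⁻ a, ∫⁻ x, h (snocIic n (u, (a, x))) * z (a, x) ∂(E.dist (μ a)) ∂(S.nextArm n u) := by
      have hm : Measurable fun p : (Finset.Iic n → Fin K × ℝ) × Fin K =>
          ∫⁻ x, h (snocIic n (p.1, (p.2, x))) * z (p.2, x)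
            ∂(Kernel.prodMkLeft (Finset.Iic n → Fin K × ℝ) (armKernel μ) p) :=
        Measurable.lintegral_kernel_prod_right'
          (f := fun q : ((Finset.Iic n → Fin K × ℝ) × Fin K) × ℝ =>
            h (snocIic n (q.1.1, (q.1.2, q.2))) * z (q.1.2, q.2)) (by fun_prop)
      exact Measurable.lintegral_kernel_prod_right' hm
    have e1 := ih hin
    have e2 := S.lintegral_law_succ μ n
      (F := fun p => h (snocIic n p) * ((∏ i : Finset.Iic n, z (p.1 i)) * z p.2)) (by fun_prop)
    -- The last observation is moved from `lam` to `μ`, the induction hypothesis is applied to the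
    -- resulting function of the past, and the last round is integrated back in.
    refine Eq.trans ?_ (e1.trans (Eq.trans ?_ e2.symm) |>.trans ?_)
    · refine lintegral_congr fun ω => lintegral_congr fun a => ?_
      exact hchange a _ (by fun_prop)
    · refine lintegral_congr fun ω => ?_
      rw [mul_comm, ← lintegral_const_mul _ (measurable_of_countable _)]
      refine lintegral_congr fun a => ?_
      rw [← lintegral_const_mul _ (by fun_prop)]
      refine lintegral_congr fun x => ?_
      have : ∏ i : Finset.Iic n, z (Preorder.frestrictLe (π := fun _ => Fin K × ℝ) n ω i) =
          ∏ i ∈ Finset.range (n + 1), z (ω i) := by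
        rw [Nat.range_succ_eq_Iic]
        exact Finset.prod_coe_sort _ fun i => z (ω i)
      simp only [this]
      ring
    · refine lintegral_congr fun ω => ?_
      have : ∏ i : Finset.Iic n, z (Preorder.frestrictLe (π := fun _ => Fin K × ℝ) n ω i) =
          ∏ i ∈ Finset.range (n + 1), z (ω i) := by
        rw [Nat.range_succ_eq_Iic]
        exact Finset.prod_coe_sort _ fun i => z (ω i)
      rw [Finset.prod_range_succ _ (n + 1)]
      simp only [this]

/-- Change of measure: on `F_n` the likelihood ratio of the models `lam` and `μ` is the product
of the likelihood ratios of the first `n` observations. -/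
theorem law_apply_eq_setLIntegral (hz : Measurable z)
    (hd : ∀ a, E.dist (lam a) = (E.dist (μ a)).withDensity fun x => z (a, x)) {n : ℕ}
    {s : Set (Trajectory K)} (hs : MeasurableSet[obsFiltration K n] s) :
    S.law lam s = ∫⁻ ω in s, ∏ i ∈ Finset.range n, z (ω i) ∂(S.law μ) := by
  cases n with
  | zero =>
    rcases obsFiltration_zero hs with rfl | rfl
    · simp
    · simp
  | succ n =>
    obtain ⟨B, hB, rfl⟩ := exists_preimage_frestrictLe hs
    have hm : MeasurableSet (Preorder.frestrictLe (π := fun _ => Fin K × ℝ) n ⁻¹' B) :=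
      measurableSet_preimage (by fun_prop) hB
    have h := S.lintegral_law_eq_mul_prod hz hd n (h := B.indicator 1)
      (measurable_one.indicator hB)
    rw [← lintegral_indicator_one hm, ← lintegral_indicator hm]
    refine h.trans (lintegral_congr fun ω => ?_)
    by_cases hω : Preorder.frestrictLe (π := fun _ => Fin K × ℝ) n ω ∈ B
    · simp [Set.indicator, hω]
    · simp [Set.indicator, hω]

end SamplingRule

/-! ### Stopped sums and Wald's identity -/

namespace Strategy

variable {E : ExpFamily} {K M : ℕ} (A : Strategy K M) (μ : Fin K → E.meanSet)

/-- The expected number of pulls of the arm `a` before the strategy stops. -/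
def expectedPulls (a : Fin K) : ℝ≥0∞ :=
  ∑' n : ℕ, A.sampling.law μ ({ω | (n : WithTop ℕ) < A.τ ω} ∩ {ω | (ω n).1 = a})

/-- The sum of `φ` over the rounds played before the strategy stops. -/
def stoppedSum (φ : Fin K × ℝ → ℝ≥0∞) (ω : Trajectory K) : ℝ≥0∞ :=
  ∑' n : ℕ, {ω | (n : WithTop ℕ) < A.τ ω}.indicator (fun ω => φ (ω n)) ω

/-- The likelihood ratio `∏ z` at the stopping time, on the event that the strategy stops with a
recommendation in `J`. -/
def stoppedRatio (z : Fin K × ℝ → ℝ≥0∞) (J : Set (Fin M)) (ω : Trajectory K) : ℝ≥0∞ :=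
  ∑' n : ℕ, ({ω | A.τ ω = n} ∩ A.recommend ⁻¹' J).indicator
    (fun ω => ∏ i ∈ Finset.range n, z (ω i)) ω

/-- Entry `n` belongs to round `n + 1`, and whether that round is played is decided by the first `n`
rounds. This predictability is what Wald's identity needs. -/
theorem measurableSet_lt (n : ℕ) :
    MeasurableSet[obsFiltration K n] {ω | (n : WithTop ℕ) < A.τ ω} := by
  have : {ω | (n : WithTop ℕ) < A.τ ω} = {ω | A.τ ω ≤ n}ᶜ := by ext; simp
  rw [this]
  exact (A.isStoppingTime n).compl

theorem measurableSet_eq_inter (n : ℕ) (J : Set (Fin M)) :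
    MeasurableSet[obsFiltration K n] ({ω | A.τ ω = n} ∩ A.recommend ⁻¹' J) := by
  have h1 : MeasurableSet[A.isStoppingTime.measurableSpace] (A.recommend ⁻¹' J) :=
    A.measurable_recommend (Set.toFinite J).measurableSet
  -- Intersecting with {τ ≤ n} brings in the definition of the stopped σ-algebra.
  have h2 : {ω | A.τ ω = n} ∩ A.recommend ⁻¹' J =
      {ω | A.τ ω = n} ∩ (A.recommend ⁻¹' J ∩ {ω | A.τ ω ≤ n}) := by
    ext ω
    simp only [Set.mem_inter_iff, Set.mem_ofPred_eq, Set.mem_preimage]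
    constructor
    · rintro ⟨h, h'⟩
      exact ⟨h, h', h.le⟩
    · rintro ⟨h, h', -⟩
      exact ⟨h, h'⟩
  rw [h2]
  exact (A.isStoppingTime.measurableSet_eq n).inter (h1.2 n)

theorem measurable_stoppedSum {φ : Fin K × ℝ → ℝ≥0∞} (hφ : Measurable φ) :
    Measurable (A.stoppedSum φ) :=
  Measurable.tsum fun n => (Measurable.indicator (by fun_prop)
    ((obsFiltration K).le n _ (A.measurableSet_lt n)))

theorem measurable_stoppedRatio {z : Fin K × ℝ → ℝ≥0∞} (hz : Measurable z) (J : Set (Fin M)) :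
    Measurable (A.stoppedRatio z J) :=
  Measurable.tsum fun n => (Measurable.indicator (by fun_prop)
    ((obsFiltration K).le n _ (A.measurableSet_eq_inter n J)))

theorem stoppedSum_of_eq (φ : Fin K × ℝ → ℝ≥0∞) {ω : Trajectory K} {N : ℕ} (h : A.τ ω = N) :
    A.stoppedSum φ ω = ∑ i ∈ Finset.range N, φ (ω i) := by
  rw [stoppedSum, tsum_eq_sum (s := Finset.range N)]
  · refine Finset.sum_congr rfl fun i hi => ?_
    have : i < N := by simpa using hi
    simp [Set.indicator, h, this]
  · intro n hn
    have : ¬ n < N := by simpa using hn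
    simp [Set.indicator, h, this]

theorem stoppedRatio_of_eq (z : Fin K × ℝ → ℝ≥0∞) (J : Set (Fin M)) {ω : Trajectory K} {N : ℕ}
    (h : A.τ ω = N) [Decidable (A.recommend ω ∈ J)] :
    A.stoppedRatio z J ω =
      if A.recommend ω ∈ J then ∏ i ∈ Finset.range N, z (ω i) else 0 := by
  rw [stoppedRatio, tsum_eq_single N]
  · simp [Set.indicator, h]
  · intro n hn
    have : N ≠ n := hn.symm
    simp [Set.indicator, h, this]

theorem stoppedSum_one (ω : Trajectory K) :
    A.stoppedSum (fun _ => 1) ω = ENat.toENNReal (A.τ ω) := by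
  cases h : A.τ ω with
  | top =>
    have h1 : ∀ n : ℕ, {ω | (n : WithTop ℕ) < A.τ ω}.indicator (fun _ => (1 : ℝ≥0∞)) ω = 1 :=
      fun n => Set.indicator_of_mem (by
        rw [Set.mem_ofPred_eq, h]
        exact WithTop.coe_lt_top n) _
    rw [stoppedSum, tsum_congr h1, ENNReal.tsum_const_eq_top_of_ne_zero one_ne_zero]
    rfl
  | coe N =>
    rw [A.stoppedSum_of_eq _ h]
    simp
    rfl

theorem setLIntegral_arm (P : Measure (Trajectory K)) (s : Set (Trajectory K)) (n : ℕ)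
    (c : Fin K → ℝ≥0∞) :
    ∫⁻ ω in s, c (ω n).1 ∂P = ∑ a, P (s ∩ {ω | (ω n).1 = a}) * c a := by
  have hf : Measurable fun ω : Trajectory K => (ω n).1 := by fun_prop
  rw [← lintegral_map (f := c) (measurable_of_countable c) hf, lintegral_fintype]
  refine Finset.sum_congr rfl fun a _ => ?_
  rw [Measure.map_apply hf (measurableSet_singleton a),
    Measure.restrict_apply (hf (measurableSet_singleton a)), Set.inter_comm, mul_comm]
  rfl

/-- Wald's identity. -/
theorem lintegral_stoppedSum {φ : Fin K × ℝ → ℝ≥0∞} (hφ : Measurable φ) :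
    ∫⁻ ω, A.stoppedSum φ ω ∂(A.sampling.law μ) =
      ∑ a, A.expectedPulls μ a * ∫⁻ x, φ (a, x) ∂(E.dist (μ a)) := by
  have hm := fun n => (obsFiltration K).le n _ (A.measurableSet_lt n)
  have h1 : ∫⁻ ω, A.stoppedSum φ ω ∂(A.sampling.law μ) =
      ∑' n : ℕ, ∫⁻ ω in {ω | (n : WithTop ℕ) < A.τ ω}, φ (ω n) ∂(A.sampling.law μ) := by
    simp only [stoppedSum]
    rw [lintegral_tsum fun n => (Measurable.indicator (by fun_prop) (hm n)).aemeasurable]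
    exact tsum_congr fun n => lintegral_indicator (hm n) _
  have h2 : ∀ n : ℕ, ∫⁻ ω in {ω | (n : WithTop ℕ) < A.τ ω}, φ (ω n) ∂(A.sampling.law μ) =
      ∑ a, A.sampling.law μ ({ω | (n : WithTop ℕ) < A.τ ω} ∩ {ω | (ω n).1 = a}) *
        ∫⁻ x, φ (a, x) ∂(E.dist (μ a)) := fun n =>
    (A.sampling.setLIntegral_law μ (A.measurableSet_lt n) hφ).trans
      (setLIntegral_arm _ _ n fun a => ∫⁻ x, φ (a, x) ∂(E.dist (μ a)))
  rw [h1, tsum_congr h2, Summable.tsum_finsetSum fun _ _ => ENNReal.summable]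
  exact Finset.sum_congr rfl fun a _ => ENNReal.tsum_mul_right

theorem expectedTime_eq_lintegral :
    A.expectedTime μ = ∫⁻ ω, A.stoppedSum (fun _ => 1) ω ∂(A.sampling.law μ) := by
  simp_rw [stoppedSum_one]
  rfl

theorem expectedTime_eq_sum : A.expectedTime μ = ∑ a, A.expectedPulls μ a := by
  rw [expectedTime_eq_lintegral, A.lintegral_stoppedSum μ measurable_const]
  simp

theorem ae_ne_top (h : A.expectedTime μ ≠ ∞) : ∀ᵐ ω ∂(A.sampling.law μ), A.τ ω ≠ ⊤ := by
  rw [expectedTime_eq_lintegral] at h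
  filter_upwards [ae_lt_top (A.measurable_stoppedSum measurable_const) h] with ω hω hτ
  rw [stoppedSum_one, hτ] at hω
  exact lt_irrefl _ hω

/-! ### Change of measure at the stopping time -/

variable {μ} {lam : Fin K → E.meanSet}

theorem stopped_eq_iUnion (J : Set (Fin M)) :
    {ω | A.τ ω ≠ ⊤ ∧ A.recommend ω ∈ J} =
      ⋃ n : ℕ, ({ω | A.τ ω = n} ∩ A.recommend ⁻¹' J) := by
  ext ω
  simp only [Set.mem_ofPred_eq, Set.mem_iUnion, Set.mem_inter_iff, Set.mem_preimage,
    exists_and_right, WithTop.ne_top_iff_exists, eq_comm]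
  rfl

/-- The event is split according to the value of τ; each piece lies in some F_n, where the
likelihood ratio is a finite product. -/
theorem lintegral_stoppedRatio {z : Fin K × ℝ → ℝ≥0∞} (hz : Measurable z)
    (hd : ∀ a, E.dist (lam a) = (E.dist (μ a)).withDensity fun x => z (a, x)) (J : Set (Fin M)) :
    ∫⁻ ω, A.stoppedRatio z J ω ∂(A.sampling.law μ) =
      A.sampling.law lam {ω | A.τ ω ≠ ⊤ ∧ A.recommend ω ∈ J} := by
  have hle := (obsFiltration K).le
  have hm := fun n => hle n _ (A.measurableSet_eq_inter n J)
  simp only [stoppedRatio]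
  rw [lintegral_tsum fun n => (Measurable.indicator (by fun_prop) (hm n)).aemeasurable, A.stopped_eq_iUnion,
    measure_iUnion _ hm]
  · refine tsum_congr fun n => ?_
    rw [lintegral_indicator (hm n),
      A.sampling.law_apply_eq_setLIntegral hz hd (A.measurableSet_eq_inter n J)]
  · intro i j hij
    refine Set.disjoint_left.2 fun ω hi hj => hij ?_
    have := hi.1.symm.trans hj.1
    exact_mod_cast this

theorem measurableSet_stopped (J : Set (Fin M)) :
    MeasurableSet {ω | A.τ ω ≠ ⊤ ∧ A.recommend ω ∈ J} := by
  rw [A.stopped_eq_iUnion]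
  exact MeasurableSet.iUnion fun n => (obsFiltration K).le n _ (A.measurableSet_eq_inter n J)

/-- The pointwise form of the change of measure inequality. -/
theorem stopped_pointwise_bound {ρ : Fin K × ℝ → ℝ} (hpos : ∀ y, 0 < ρ y) {r : ℝ} (hr : 1 ≤ r)
    (J : Set (Fin M)) {ω : Trajectory K} (hω : A.τ ω ≠ ⊤) :
    {ω | A.τ ω ≠ ⊤ ∧ A.recommend ω ∈ J}.indicator
        (fun _ => ENNReal.ofReal (2 * Real.log r)) ω +
        A.stoppedSum (fun y => ENNReal.ofReal (ρ y)) ω + 1 ≤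
      A.stoppedSum (fun y => ENNReal.ofReal (ρ y - 1 - Real.log (ρ y))) ω +
        A.stoppedSum (fun _ => 1) ω +
        (ENNReal.ofReal r * A.stoppedRatio (fun y => ENNReal.ofReal (ρ y)) J ω +
          ENNReal.ofReal r⁻¹ * A.stoppedRatio (fun y => ENNReal.ofReal (ρ y)) Jᶜ ω) +
        ENNReal.ofReal (Real.log r) := by
  classical
  obtain ⟨N, hN⟩ := WithTop.ne_top_iff_exists.1 hω
  have hN' := hN.symm
  have hr0 : 0 < r := by linarith
  have hc : 0 ≤ Real.log r := Real.log_nonneg hr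
  have hg : ∀ y, 0 ≤ ρ y - 1 - Real.log (ρ y) := fun y => by
    linarith [Real.log_le_sub_one_of_pos (hpos y)]
  have hS : 0 ≤ ∑ i ∈ Finset.range N, ρ (ω i) := Finset.sum_nonneg fun i _ => (hpos _).le
  have hG : 0 ≤ ∑ i ∈ Finset.range N, (ρ (ω i) - 1 - Real.log (ρ (ω i))) :=
    Finset.sum_nonneg fun i _ => hg _
  have hZ : 0 < ∏ i ∈ Finset.range N, ρ (ω i) := Finset.prod_pos fun i _ => hpos _
  -- Used with s = r when the recommendation lies in J and with s = r⁻¹ otherwise.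
  have hlog : ∀ s : ℝ, 0 < s → Real.log s + ∑ i ∈ Finset.range N, Real.log (ρ (ω i)) ≤
      s * ∏ i ∈ Finset.range N, ρ (ω i) - 1 := by
    intro s hs
    rw [← Real.log_prod fun i _ => (hpos _).ne', ← Real.log_mul hs.ne' hZ.ne']
    exact Real.log_le_sub_one_of_pos (by positivity)
  simp only [A.stoppedSum_of_eq _ hN', A.stoppedRatio_of_eq _ _ hN', Set.mem_compl_iff,
    ← ENNReal.ofReal_prod_of_nonneg fun i _ => (hpos _).le,
    ← ENNReal.ofReal_sum_of_nonneg fun i _ => (hpos _).le,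
    ← ENNReal.ofReal_sum_of_nonneg fun i _ => hg _]
  have hNN : ∑ i ∈ Finset.range N, (1 : ℝ≥0∞) = ENNReal.ofReal N := by simp
  rw [hNN]
  have hsplit : ∑ i ∈ Finset.range N, (ρ (ω i) - 1 - Real.log (ρ (ω i))) =
      ∑ i ∈ Finset.range N, ρ (ω i) - N - ∑ i ∈ Finset.range N, Real.log (ρ (ω i)) := by
    simp [Finset.sum_sub_distrib]
  by_cases hJ : A.recommend ω ∈ J
  · have h := hlog r hr0
    simp only [Set.indicator, Set.mem_ofPred_eq, hω, hJ, ne_eq, not_false_eq_true, and_self,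
      not_true_eq_false, if_true, if_false, mul_zero, add_zero]
    rw [← ENNReal.ofReal_mul hr0.le, ← ENNReal.ofReal_one,
      ← ENNReal.ofReal_add (by positivity) hS,
      ← ENNReal.ofReal_add (by positivity) (by positivity),
      ← ENNReal.ofReal_add hG (by positivity),
      ← ENNReal.ofReal_add (by positivity) (by positivity),
      ← ENNReal.ofReal_add (by positivity) (by positivity)]
    refine ENNReal.ofReal_le_ofReal ?_
    linarith
  · have h := hlog r⁻¹ (by positivity)
    rw [Real.log_inv] at h
    simp only [Set.indicator, Set.mem_ofPred_eq, hJ, and_false,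
      not_false_eq_true, if_true, if_false, mul_zero, zero_add]
    rw [← ENNReal.ofReal_mul (by positivity), ← ENNReal.ofReal_one,
      ← ENNReal.ofReal_add hS (by positivity),
      ← ENNReal.ofReal_add hG (by positivity),
      ← ENNReal.ofReal_add (by positivity) (by positivity),
      ← ENNReal.ofReal_add (by positivity) (by positivity)]
    refine ENNReal.ofReal_le_ofReal ?_
    linarith

/-- If a strategy stops almost surely under `μ`, recommends an element of `J` with probability at
least `1 - δ` under `μ` and at most `δ` under `lam`, then it collects at least
`(1 - 2 δ) log ((1 - δ) / δ)` units of information. -/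
theorem le_sum_expectedPulls_mul_of_withDensity {ρ : Fin K × ℝ → ℝ} (hρ : Measurable ρ)
    (hpos : ∀ y, 0 < ρ y)
    (hd : ∀ a, E.dist (lam a) = (E.dist (μ a)).withDensity fun x => ENNReal.ofReal (ρ (a, x)))
    {δ : ℝ} (h0 : 0 < δ) (h1 : δ < 1 / 2) (hfin : A.expectedTime μ ≠ ∞) (J : Set (Fin M))
    (hμ : ENNReal.ofReal (1 - δ) ≤ A.sampling.law μ {ω | A.τ ω ≠ ⊤ ∧ A.recommend ω ∈ J})
    (hlam : A.sampling.law lam {ω | A.τ ω ≠ ⊤ ∧ A.recommend ω ∈ J} ≤ ENNReal.ofReal δ) :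
    ENNReal.ofReal ((1 - 2 * δ) * Real.log ((1 - δ) / δ)) ≤
      ∑ a, A.expectedPulls μ a * E.d (μ a) (lam a) := by
  -- This r satisfies rδ + (1 - δ)/r = 1, which offsets the constant 1 in the pointwise bound.
  set r : ℝ := (1 - δ) / δ with hr
  have hr1 : 1 ≤ r := by rw [hr, le_div_iff₀ h0]; linarith
  have hr0 : 0 < r := by linarith
  have hc : 0 ≤ Real.log r := Real.log_nonneg hr1
  have hz : Measurable fun y => ENNReal.ofReal (ρ y) := by fun_prop
  have hint := lintegral_mono_ae ((A.ae_ne_top μ hfin).mono fun ω hω =>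
    A.stopped_pointwise_bound hpos hr1 J hω)
  have m1 := A.measurable_stoppedSum hz
  have m2 := A.measurable_stoppedSum (φ := fun y => ENNReal.ofReal (ρ y - 1 - Real.log (ρ y)))
    (by fun_prop)
  have m3 := A.measurable_stoppedSum (φ := fun _ => 1) measurable_const
  have m4 := A.measurable_stoppedRatio hz J
  have m5 := A.measurable_stoppedRatio hz Jᶜ
  rw [lintegral_add_right _ measurable_const, lintegral_add_right _ m1,
    lintegral_add_right _ measurable_const, lintegral_add_right _ (by fun_prop),
    lintegral_add_right _ m3, lintegral_add_right _ (by fun_prop),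
    lintegral_const_mul _ m4, lintegral_const_mul _ m5,
    A.lintegral_stoppedRatio hz hd, A.lintegral_stoppedRatio hz hd,
    ← A.expectedTime_eq_lintegral, A.lintegral_stoppedSum μ hz,
    A.lintegral_stoppedSum μ (by fun_prop),
    lintegral_indicator_const (A.measurableSet_stopped J), lintegral_const, lintegral_const,
    measure_univ, mul_one, mul_one] at hint
  -- Each density ratio has mean 1 under `μ`, so the stopped sum of ρ has expectation E_μ[τ] and can
  -- be cancelled against it.
  have hone : ∀ a, ∫⁻ x, ENNReal.ofReal (ρ (a, x)) ∂(E.dist (μ a)) = 1 := by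
    intro a
    have := measure_univ (μ := E.dist (lam a))
    rwa [hd a, withDensity_apply _ MeasurableSet.univ, setLIntegral_univ] at this
  have hkl : ∀ a, ∫⁻ x, ENNReal.ofReal (ρ (a, x) - 1 - Real.log (ρ (a, x))) ∂(E.dist (μ a)) =
      E.d (μ a) (lam a) := fun a =>
    (klDiv_eq_lintegral_of_withDensity (z := fun x => ρ (a, x)) (by fun_prop)
      (fun x => hpos _) (hd a)).symm
  simp only [hone, hkl, mul_one] at hint
  rw [← A.expectedTime_eq_sum] at hint
  have hratio : ENNReal.ofReal r * A.sampling.law lam {ω | A.τ ω ≠ ⊤ ∧ A.recommend ω ∈ J} +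
      ENNReal.ofReal r⁻¹ * A.sampling.law lam {ω | A.τ ω ≠ ⊤ ∧ A.recommend ω ∈ Jᶜ} ≤ 1 := by
    have hsum : A.sampling.law lam {ω | A.τ ω ≠ ⊤ ∧ A.recommend ω ∈ J} +
        A.sampling.law lam {ω | A.τ ω ≠ ⊤ ∧ A.recommend ω ∈ Jᶜ} ≤ 1 := by
      rw [← measure_union _ (A.measurableSet_stopped Jᶜ)]
      · exact prob_le_one
      · exact Set.disjoint_left.2 fun ω hω hω' => hω'.2 hω.2
    generalize A.sampling.law lam {ω | A.τ ω ≠ ⊤ ∧ A.recommend ω ∈ J} = p at hsum hlam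
    generalize A.sampling.law lam {ω | A.τ ω ≠ ⊤ ∧ A.recommend ω ∈ Jᶜ} = q at hsum
    have hp : p ≠ ∞ := ne_top_of_le_ne_top ENNReal.one_ne_top (le_self_add.trans hsum)
    have hq : q ≠ ∞ := ne_top_of_le_ne_top ENNReal.one_ne_top (le_add_self.trans hsum)
    lift p to NNReal using hp
    lift q to NNReal using hq
    have hs : (p : ℝ) + q ≤ 1 := by exact_mod_cast hsum
    have hpδ : (p : ℝ) ≤ δ := by
      rw [← ENNReal.ofReal_coe_nnreal] at hlam
      exact (ENNReal.ofReal_le_ofReal_iff h0.le).1 hlam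
    rw [← ENNReal.ofReal_coe_nnreal, ← ENNReal.ofReal_coe_nnreal, ← ENNReal.ofReal_mul hr0.le,
      ← ENNReal.ofReal_mul (by positivity), ← ENNReal.ofReal_add (by positivity) (by positivity),
      ← ENNReal.ofReal_one]
    refine ENNReal.ofReal_le_ofReal ?_
    have hinv : r⁻¹ ≤ r := (inv_le_one_of_one_le₀ hr1).trans hr1
    have e1 : r * δ = 1 - δ := by rw [hr]; field_simp
    have e2 : r⁻¹ * (1 - δ) = δ := by
      have : 1 - δ ≠ 0 := by linarith
      rw [hr]; field_simp
    have e3 : r⁻¹ * q ≤ r⁻¹ * (1 - p) := mul_le_mul_of_nonneg_left (by linarith) (by positivity)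
    -- Since r⁻¹ ≤ r, the bound rp + r⁻¹(1 - p) increases with p and is largest at p = δ.
    nlinarith [mul_nonneg (sub_nonneg.2 hinv) (sub_nonneg.2 hpδ)]
  have hcancel : ENNReal.ofReal (2 * Real.log r) *
        A.sampling.law μ {ω | A.τ ω ≠ ⊤ ∧ A.recommend ω ∈ J} ≤
      ∑ a, A.expectedPulls μ a * E.d (μ a) (lam a) + ENNReal.ofReal (Real.log r) := by
    have h2 := hint.trans (add_le_add_left (add_le_add_right hratio _) _)
    have hT : A.expectedTime μ + 1 ≠ ∞ := ENNReal.add_ne_top.2 ⟨hfin, ENNReal.one_ne_top⟩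
    refine (ENNReal.add_le_add_iff_right hT).1 ?_
    calc _ = _ := by rw [← add_assoc]
      _ ≤ _ := h2
      _ = _ := by ring
  have h3 : ENNReal.ofReal (2 * Real.log r * (1 - δ)) ≤
      ∑ a, A.expectedPulls μ a * E.d (μ a) (lam a) + ENNReal.ofReal (Real.log r) := by
    rw [ENNReal.ofReal_mul (by positivity)]
    exact (mul_le_mul_right hμ _).trans hcancel
  have h4 : (1 - 2 * δ) * Real.log r = 2 * Real.log r * (1 - δ) - Real.log r := by ring
  rw [h4, ENNReal.ofReal_sub _ hc]
  exact tsub_le_iff_right.2 h3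

/-- Two members of an exponential family always have an everywhere positive density ratio, the
exponential of an affine function. -/
theorem le_sum_expectedPulls_mul
    {δ : ℝ} (h0 : 0 < δ) (h1 : δ < 1 / 2) (hfin : A.expectedTime μ ≠ ∞) (J : Set (Fin M))
    (hμ : ENNReal.ofReal (1 - δ) ≤ A.sampling.law μ {ω | A.τ ω ≠ ⊤ ∧ A.recommend ω ∈ J})
    (hlam : A.sampling.law lam {ω | A.τ ω ≠ ⊤ ∧ A.recommend ω ∈ J} ≤ ENNReal.ofReal δ) :
    ENNReal.ofReal ((1 - 2 * δ) * Real.log ((1 - δ) / δ)) ≤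
      ∑ a, A.expectedPulls μ a * E.d (μ a) (lam a) := by
  let θ : (Fin K → E.meanSet) → Fin K → ℝ := fun κ a => E.naturalParam (κ a)
  have hθ : ∀ κ : Fin K → E.meanSet, Measurable fun y : Fin K × ℝ => θ κ y.1 := fun κ =>
    (measurable_of_countable (θ κ)).comp measurable_fst
  have hb : ∀ κ : Fin K → E.meanSet, Measurable fun y : Fin K × ℝ => E.b (θ κ y.1) := fun κ =>
    (measurable_of_countable fun a => E.b (θ κ a)).comp measurable_fst
  refine A.le_sum_expectedPulls_mul_of_withDensity
    (ρ := fun y => Real.exp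
      ((y.2 * θ lam y.1 - E.b (θ lam y.1)) - (y.2 * θ μ y.1 - E.b (θ μ y.1))))
    ?_ (fun _ => Real.exp_pos _) (fun a => ?_) h0 h1 hfin J hμ hlam
  · exact Real.measurable_exp.comp (((measurable_snd.mul (hθ lam)).sub (hb lam)).sub
      ((measurable_snd.mul (hθ μ)).sub (hb μ)))
  · exact withDensity_exp_ratio E.m (by fun_prop) (by fun_prop)

/-- A `δ`-correct strategy whose expected duration under `μ` is finite has to gather enough
information to reject every alternative. -/
theorem IsDeltaCorrect.log_le_sum {P : IdentificationProblem E K M} {δ : ℝ} {A : Strategy K M}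
    (hA : A.IsDeltaCorrect P δ) (h0 : 0 < δ) (h1 : δ < 1 / 2) (hμ : μ ∈ P.params)
    (hfin : A.expectedTime μ ≠ ∞) (hlam : lam ∈ P.alt μ) :
    ENNReal.ofReal (Real.log (1 / (3 * δ))) ≤
      ∑ a, A.expectedPulls μ a * E.d (μ a) (lam a) := by
  refine (ENNReal.ofReal_le_ofReal (log_one_div_three_mul_le h0 h1)).trans
    (A.le_sum_expectedPulls_mul h0 h1 hfin {i | μ ∈ P.cell i} ?_ ?_)
  · have h := hA μ hμ
    have hae : {ω | A.τ ω ≠ ⊤ ∧ A.recommend ω ∈ {i | μ ∈ P.cell i}} =ᵐ[A.sampling.law μ]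
        ({ω | A.τ ω ≠ ⊤ ∧ μ ∉ P.cell (A.recommend ω)}ᶜ : Set (Trajectory K)) := by
      filter_upwards [A.ae_ne_top μ hfin] with ω hω
      refine propext ?_
      change (_ ∧ _) ↔ ¬ (_ ∧ _)
      simp [hω]
    have hm : MeasurableSet {ω | A.τ ω ≠ ⊤ ∧ μ ∉ P.cell (A.recommend ω)} :=
      A.measurableSet_stopped {i | μ ∉ P.cell i}
    rw [measure_congr hae, prob_compl_eq_one_sub hm, ENNReal.ofReal_sub _ h0.le,
      ENNReal.ofReal_one]
    exact tsub_le_tsub_left h _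
  · obtain ⟨i, hi, hlam⟩ := Set.mem_iUnion₂.1 hlam
    refine (measure_mono ?_).trans (hA lam (Set.mem_iUnion.2 ⟨i, hlam⟩))
    rintro ω ⟨hτ, hω⟩
    refine ⟨hτ, fun hl => ?_⟩
    -- The recommended cell contains `μ` and cell `i` does not, so disjointness makes the
    -- recommendation wrong for `lam`.
    have hne : i ≠ A.recommend ω := fun h => hi (h ▸ hω)
    exact Set.disjoint_left.1 (P.disjoint_cell hne) hlam hl

end Strategy

/-! ### From expected pulls to the complexity -/

theorem IdentificationProblem.complexity_mul_le {E : ExpFamily} {K M : ℕ}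
    (P : IdentificationProblem E K M) {μ : Fin K → E.meanSet} [Nonempty (Fin K)]
    {L : ℝ≥0∞} (hL : L ≠ 0) (hL' : L ≠ ∞) (n : Fin K → ℝ≥0∞) (hn : ∑ a, n a ≠ ∞)
    (h : ∀ lam ∈ P.alt μ, L ≤ ∑ a, n a * E.d (μ a) (lam a)) :
    P.complexity μ * L ≤ ∑ a, n a := by
  set T := ∑ a, n a with hT
  -- With no pulls, L ≠ 0 leaves no alternative; the infimum over the empty set is ∞ and the
  -- complexity is 0.
  by_cases hT0 : T = 0
  · have hna : ∀ a, n a = 0 := fun a => Finset.sum_eq_zero_iff.1 hT0 a (Finset.mem_univ a)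
    have halt : ∀ lam, lam ∉ P.alt μ := fun lam hl => hL (by simpa [hna] using h lam hl)
    have a : Fin K := Classical.arbitrary _
    have htop : P.complexity μ = 0 := by
      rw [IdentificationProblem.complexity, ENNReal.inv_eq_zero]
      refine top_unique ((le_iInf₂ fun lam hl => absurd hl (halt lam)).trans
        (le_iSup₂ (f := fun w (_ : w ∈ stdSimplex ℝ (Fin K)) => ⨅ lam ∈ P.alt μ,
          ∑ a, ENNReal.ofReal (w a) * E.d (μ a) (lam a)) _ (single_mem_stdSimplex ℝ a)))
    simp [htop]
  have hna : ∀ a, n a ≠ ∞ := fun a => ne_top_of_le_ne_top hn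
    (Finset.single_le_sum (f := n) (fun _ _ => zero_le) (Finset.mem_univ a))
  -- The weights are the proportions of expected pulls.
  have hw : (fun a => (n a / T).toReal) ∈ stdSimplex ℝ (Fin K) := by
    refine ⟨fun a => ENNReal.toReal_nonneg, ?_⟩
    rw [← ENNReal.toReal_sum fun a _ => ENNReal.div_ne_top (hna a) hT0]
    simp_rw [div_eq_mul_inv]
    rw [← Finset.sum_mul, ← hT, ENNReal.mul_inv_cancel hT0 hn, ENNReal.toReal_one]
  have hsup : L / T ≤ (P.complexity μ)⁻¹ := by
    rw [IdentificationProblem.complexity, inv_inv]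
    refine le_trans ?_ (le_iSup₂ (f := fun w (_ : w ∈ stdSimplex ℝ (Fin K)) => ⨅ lam ∈ P.alt μ,
      ∑ a, ENNReal.ofReal (w a) * E.d (μ a) (lam a)) _ hw)
    refine le_iInf₂ fun lam hl => ?_
    simp_rw [ENNReal.ofReal_toReal (ENNReal.div_ne_top (hna _) hT0)]
    refine (ENNReal.div_le_div_right (h lam hl) T).trans (le_of_eq ?_)
    simp_rw [div_eq_mul_inv]
    rw [Finset.sum_mul]
    exact Finset.sum_congr rfl fun a _ => by ring
  rw [← ENNReal.inv_le_inv, inv_inv, ENNReal.inv_div (Or.inl hn) (Or.inl hT0)] at hsup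
  exact (mul_le_mul_left hsup L).trans (ENNReal.div_mul_cancel hL hL').le

end

/-- The lower bound is an inequality in `[0, ∞]`; `ENNReal.ofReal` replaces `ln (1 / (3δ))` by `0`
when it is negative, in which case the bound says nothing. -/
theorem proposition5p2 (E : ExpFamily) (K M : ℕ) (P : IdentificationProblem E K M)
    (δ : ℝ) (hδ : 0 < δ) (hδ' : δ ≤ 1)
    (A : Strategy K M) (hA : A.IsDeltaCorrect P δ) :
    ∀ μ ∈ P.params,
      P.complexity μ * ENNReal.ofReal (Real.log (1 / (3 * δ))) ≤ A.expectedTime μ := by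
  intro μ hμ
  by_cases hlog : Real.log (1 / (3 * δ)) ≤ 0
  · rw [ENNReal.ofReal_of_nonpos hlog, mul_zero]
    exact zero_le
  by_cases hfin : A.expectedTime μ = ∞
  · simp [hfin]
  have hL : ENNReal.ofReal (Real.log (1 / (3 * δ))) ≠ 0 := by
    simpa using hlog
  -- A positive logarithm means 3δ < 1.
  have h1 : δ < 1 / 2 := by
    have := (Real.log_pos_iff (by positivity)).1 (not_le.1 hlog)
    rw [lt_div_iff₀ (by positivity)] at this
    linarith
  have : Nonempty (Fin K) := ⟨A.sampling.first 0⟩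
  rw [A.expectedTime_eq_sum μ] at hfin ⊢
  refine P.complexity_mul_le hL ENNReal.ofReal_ne_top _ hfin fun lam hlam => ?_
  rw [← A.expectedTime_eq_sum μ] at hfin
  exact hA.log_le_sum hδ h1 hμ hfin hlam
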